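/- A lattice-ordered group ($\ell$-group) is an algebra $\langle L,\wedge,\vee,\cdot,{}^{-1},e\rangle$ such that $\langle L,\cdot,{}^{-1},e\rangle$ is a group, $\langle L,\wedge,\vee\rangle$ is a lattice with order $a\le b\Leftrightarrow a\wedge b=a$, and $a\le b$ implies $cad\le cbd$ for all $a,b,c,d\in L$. An $\ell$-group equation is a pair $s\approx t$ of terms built from variables $x_0,x_1,x_2,\dots$ with the operation symbols $\wedge,\vee,\cdot,{}^{-1},e$; it is valid in all $\ell$-groups if $s$ and $t$ take the same value in every $\ell$-group under every assignment of elements to the variables. The problem of checking whether an equation is valid in all $\ell$-groups is decidable: there is an algorithm (a computable function on the Gödel numbers of pairs of terms) which, given any $\ell$-group equation $s\approx t$, decides whether it is valid in all $\ell$-groups. -/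

import Mathlib

universe u

/-- Terms in the signature `e, ⁻¹, ·, ∧, ∨` of lattice-ordered groups, over the countably many
variables `x₀, x₁, x₂, …`. -/
inductive LGroupTerm : Type
  | var (n : ℕ) : LGroupTerm
  | one : LGroupTerm
  | inv (t : LGroupTerm) : LGroupTerm
  | mul (s t : LGroupTerm) : LGroupTerm
  | inf (s t : LGroupTerm) : LGroupTerm
  | sup (s t : LGroupTerm) : LGroupTerm

namespace LGroupTerm

/-- The value of a term in an algebra with group and lattice operations, under the assignment
`v` of elements to the variables. -/
def eval {L : Type*} [Lattice L] [Group L] (v : ℕ → L) : LGroupTerm → L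
  | var n => v n
  | one => 1
  | inv t => (eval v t)⁻¹
  | mul s t => eval v s * eval v t
  | inf s t => eval v s ⊓ eval v t
  | sup s t => eval v s ⊔ eval v t

/-- The Gödel number of a term: `0` codes `e`, and a positive number `5 * m + r + 1` with `r < 5`
codes a variable or a compound term, where `r` tells the outermost symbol and `m` is the index of
the variable, the code of the argument, or the Cantor pair of the codes of the two arguments. -/
def toCode : LGroupTerm → ℕ
  | one => 0
  | var n => 5 * n + 1
  | inv t => 5 * toCode t + 1 + 1
  | mul s t => 5 * Nat.pair (toCode s) (toCode t) + 2 + 1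
  | inf s t => 5 * Nat.pair (toCode s) (toCode t) + 3 + 1
  | sup s t => 5 * Nat.pair (toCode s) (toCode t) + 4 + 1

/-- The term with a given Gödel number. -/
def ofCode : ℕ → LGroupTerm
  | 0 => one
  | n + 1 =>
    have _h0 : n / 5 < n + 1 := by omega
    have _h1 : (n / 5).unpair.1 < n + 1 := (Nat.unpair_left_le _).trans_lt _h0
    have _h2 : (n / 5).unpair.2 < n + 1 := (Nat.unpair_right_le _).trans_lt _h0
    match n % 5 with
    | 0 => var (n / 5)
    | 1 => inv (ofCode (n / 5))
    | 2 => mul (ofCode (n / 5).unpair.1) (ofCode (n / 5).unpair.2)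
    | 3 => inf (ofCode (n / 5).unpair.1) (ofCode (n / 5).unpair.2)
    | _ => sup (ofCode (n / 5).unpair.1) (ofCode (n / 5).unpair.2)

theorem ofCode_toCode (t : LGroupTerm) : ofCode (toCode t) = t := by
  induction t with
  | one => simp [toCode, ofCode]
  | var n =>
    have h1 : 5 * n / 5 = n := by omega
    have h2 : 5 * n % 5 = 0 := by omega
    rw [toCode, ofCode, h1, h2]
    rfl
  | inv t ih =>
    have h1 : (5 * toCode t + 1) / 5 = toCode t := by omega
    have h2 : (5 * toCode t + 1) % 5 = 1 := by omega
    rw [toCode, ofCode, h1, h2]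
    simp only [ih]
  | mul s t ihs iht =>
    have h1 : (5 * Nat.pair (toCode s) (toCode t) + 2) / 5 = Nat.pair (toCode s) (toCode t) := by
      omega
    have h2 : (5 * Nat.pair (toCode s) (toCode t) + 2) % 5 = 2 := by omega
    rw [toCode, ofCode, h1, h2]
    simp only [Nat.unpair_pair, ihs, iht]
  | inf s t ihs iht =>
    have h1 : (5 * Nat.pair (toCode s) (toCode t) + 3) / 5 = Nat.pair (toCode s) (toCode t) := by
      omega
    have h2 : (5 * Nat.pair (toCode s) (toCode t) + 3) % 5 = 3 := by omega
    rw [toCode, ofCode, h1, h2]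
    simp only [Nat.unpair_pair, ihs, iht]
  | sup s t ihs iht =>
    have h1 : (5 * Nat.pair (toCode s) (toCode t) + 4) / 5 = Nat.pair (toCode s) (toCode t) := by
      omega
    have h2 : (5 * Nat.pair (toCode s) (toCode t) + 4) % 5 = 4 := by omega
    rw [toCode, ofCode, h1, h2]
    simp only [Nat.unpair_pair, ihs, iht]

theorem toCode_ofCode (n : ℕ) : toCode (ofCode n) = n := by
  induction n using Nat.strong_induction_on with
  | _ n ih =>
    cases n with
    | zero => simp [toCode, ofCode]
    | succ n =>
      have h0 : n / 5 < n + 1 := by omega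
      have h1 := ih _ ((Nat.unpair_left_le _).trans_lt h0)
      have h2 := ih _ ((Nat.unpair_right_le _).trans_lt h0)
      have h3 := ih _ h0
      have hn := Nat.div_add_mod n 5
      have hlt := Nat.mod_lt n (show 5 > 0 by norm_num)
      rw [ofCode]
      generalize hr : n % 5 = r at hn hlt
      interval_cases r <;> simp only [toCode, h1, h2, h3, Nat.pair_unpair] <;> omega

/-- The Gödel numbering is a bijection between terms and natural numbers. -/
def codeEquiv : LGroupTerm ≃ ℕ where
  toFun := toCode
  invFun := ofCode
  left_inv := ofCode_toCode
  right_inv := toCode_ofCode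

/-- Computability of problems about terms refers to the Gödel numbering `toCode`. -/
instance : Denumerable LGroupTerm := Denumerable.mk' codeEquiv

end LGroupTerm

/-- The equation `s ≈ t` is valid in all lattice-ordered groups: it holds under every assignment
in every group carrying a lattice order for which left and right multiplications are monotone. -/
def ValidInLGroups (s t : LGroupTerm) : Prop :=
  ∀ (L : Type u) [Lattice L] [Group L] [MulLeftMono L] [MulRightMono L] (v : ℕ → L),
    s.eval v = t.eval v

/-! ### The lattice-ordered group of automorphisms of a chain -/

namespace OrderIso

variable {α : Type*} [LinearOrder α]

/-! An equation fails in some ℓ-group iff a finite object of bounded size refutes it, so validity is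
decided by bounded search. By Holland's argument, distinct elements of an ℓ-group are separated by
an action on a chain: it acts on the cosets of a prime convex subgroup (`exists_hom_aut_chain_ne`).
A failing equation thus fails at a point `x` of a chain. Computing both sides at `x` visits finitely
many points, their number bounded by the codes of the terms (`exists_finset_sends`). Numbering these
points in order gives a finite table. Conversely, in any table of local justifications the entries
for a variable form a finite partial isomorphism. Placed in `ℚ`, it extends to an automorphism by
back-and-forth (`exists_orderIso_extension`). Induction on terms then makes every entry true in `Aut
ℚ` (`IsEvalTable.eval_apply`), so a table with conflicting values refutes the equation. Tables are
coded by the binary digits of a bounded number and all their conditions have bounded quantifiers, so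
validity is even primitive recursive. -/

instance instPartialOrderAut : PartialOrder (α ≃o α) :=
  PartialOrder.lift (fun f => (f : α → α)) DFunLike.coe_injective

/-- The inverse of a pointwise maximum is the pointwise minimum of the inverses; this supplies
surjectivity for `autSup`. -/
theorem max_apply_min_symm_apply (f g : α ≃o α) (y : α) :
    max (f (min (f.symm y) (g.symm y))) (g (min (f.symm y) (g.symm y))) = y := by
  rcases le_total (f.symm y) (g.symm y) with h | h
  · rw [min_eq_left h, f.apply_symm_apply, max_eq_left]
    simpa using g.monotone h
  · rw [min_eq_right h, g.apply_symm_apply, max_eq_right]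
    simpa using f.monotone h

theorem min_apply_max_symm_apply (f g : α ≃o α) (y : α) :
    min (f (max (f.symm y) (g.symm y))) (g (max (f.symm y) (g.symm y))) = y := by
  rcases le_total (f.symm y) (g.symm y) with h | h
  · rw [max_eq_right h, g.apply_symm_apply, min_eq_right]
    simpa using f.monotone h
  · rw [max_eq_left h, f.apply_symm_apply, min_eq_left]
    simpa using g.monotone h

/-- The pointwise maximum of two automorphisms of a chain. -/
def autSup (f g : α ≃o α) : α ≃o α :=
  StrictMono.orderIsoOfRightInverse (fun x => max (f x) (g x))
    (fun _ _ h => max_lt_max (f.strictMono h) (g.strictMono h))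
    (fun y => min (f.symm y) (g.symm y)) (max_apply_min_symm_apply f g)

/-- The pointwise minimum of two automorphisms of a chain. -/
def autInf (f g : α ≃o α) : α ≃o α :=
  StrictMono.orderIsoOfRightInverse (fun x => min (f x) (g x))
    (fun _ _ h => min_lt_min (f.strictMono h) (g.strictMono h))
    (fun y => max (f.symm y) (g.symm y)) (min_apply_max_symm_apply f g)

instance instLatticeAut : Lattice (α ≃o α) where
  sup := autSup
  inf := autInf
  le_sup_left f g x := le_max_left (f x) (g x)
  le_sup_right f g x := le_max_right (f x) (g x)
  sup_le _ _ _ hf hg x := max_le (hf x) (hg x)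
  inf_le_left f g x := min_le_left (f x) (g x)
  inf_le_right f g x := min_le_right (f x) (g x)
  le_inf _ _ _ hf hg x := le_min (hf x) (hg x)

theorem aut_sup_apply (f g : α ≃o α) (x : α) : (f ⊔ g) x = max (f x) (g x) := rfl

theorem aut_inf_apply (f g : α ≃o α) (x : α) : (f ⊓ g) x = min (f x) (g x) := rfl

instance instMulLeftMonoAut : MulLeftMono (α ≃o α) :=
  ⟨fun f _ _ h x => f.monotone (h x)⟩

instance instMulRightMonoAut : MulRightMono (α ≃o α) :=
  ⟨fun f _ _ h x => h (f x)⟩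

end OrderIso

/-! ### Back-and-forth extension of finite partial isomorphisms -/

namespace Order.PartialIso

/-- A finite partial isomorphism between countable dense chains without endpoints extends to an
isomorphism. -/
theorem exists_orderIso_extension {α β : Type*} [LinearOrder α] [LinearOrder β]
    [Countable α] [DenselyOrdered α] [NoMinOrder α] [NoMaxOrder α] [Nonempty α]
    [Countable β] [DenselyOrdered β] [NoMinOrder β] [NoMaxOrder β] [Nonempty β]
    (p : PartialIso α β) : ∃ F : α ≃o β, ∀ q ∈ p.val, F q.1 = q.2 := by
  cases nonempty_encodable α
  cases nonempty_encodable β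
  let 𝒟 : α ⊕ β → Cofinal (PartialIso α β) := fun s =>
    Sum.recOn s (definedAtLeft β) (definedAtRight α)
  let I : Ideal (PartialIso α β) := idealOfCofinals p 𝒟
  let F a := funOfIdeal a I (cofinal_meets_idealOfCofinals _ 𝒟 (Sum.inl a))
  let G b := invOfIdeal b I (cofinal_meets_idealOfCofinals _ 𝒟 (Sum.inr b))
  refine ⟨OrderIso.ofCmpEqCmp (fun a => (F a).val) (fun b => (G b).val) fun a b => ?_, ?_⟩
  · rcases (F a).prop with ⟨f, hf, ha⟩
    rcases (G b).prop with ⟨g, hg, hb⟩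
    rcases I.directed _ hf _ hg with ⟨m, _, fm, gm⟩
    exact m.prop (a, _) (fm ha) (_, b) (gm hb)
  · rintro ⟨a, b⟩ hq
    change (F a).val = b
    rcases (F a).prop with ⟨f, hf, ha⟩
    rcases I.directed _ hf _ (mem_idealOfCofinals p 𝒟) with ⟨m, _, fm, pm⟩
    -- Inside the common extension `m`, two pairs with equal first coordinates have equal second
    -- coordinates.
    exact (eq_iff_eq_of_cmp_eq_cmp (m.prop (a, _) (fm ha) (a, b) (pm hq))).1 rfl

end Order.PartialIso

/-! ### Representing a lattice-ordered group on a chain -/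

section Representation

open scoped Pointwise

variable {L : Type u} [Lattice L] [Group L]

/-- A convex submonoid of the positive cone of a lattice-ordered group. -/
structure IsPosConvex (T : Set L) : Prop where
  one_mem : 1 ∈ T
  one_le : ∀ x ∈ T, 1 ≤ x
  mul_mem : ∀ x ∈ T, ∀ y ∈ T, x * y ∈ T
  mem_of_le : ∀ x y, 1 ≤ x → x ≤ y → y ∈ T → x ∈ T

theorem IsPosConvex.one_le_of_mem_closure [MulLeftMono L] {T : Set L} (hT : IsPosConvex T) {a : L} (ha : 1 ≤ a)
    {u : L} (hu : u ∈ Submonoid.closure (insert a T)) : 1 ≤ u := by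
  induction hu using Submonoid.closure_induction with
  | mem x hx => exact hx.elim (fun h => h ▸ ha) (hT.one_le x)
  | one => exact le_rfl
  | mul x y _ _ hx hy => exact one_le_mul hx hy

/-- The elements lying below `x` up to right multiplication by elements of `T`. -/
def lowerCoset (T : Set L) (x : L) : Set L := {y | ∃ t ∈ T, y ≤ x * t}

theorem smul_lowerCoset [MulLeftMono L] (T : Set L) (g x : L) : g • lowerCoset T x = lowerCoset T (g * x) := by
  ext y
  simp only [Set.mem_smul_set_iff_inv_smul_mem, lowerCoset, Set.mem_ofPred_eq, smul_eq_mul,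
    inv_mul_le_iff_le_mul, mul_assoc]

/-- Lower sets stand in for the left cosets of the convex subgroup generated by `T`, and inclusion
for the order on cosets. -/
theorem IsPosConvex.lowerCoset_subset_iff [MulRightMono L] {T : Set L} (hT : IsPosConvex T) {x y : L} :
    lowerCoset T x ⊆ lowerCoset T y ↔ ∃ t ∈ T, x ≤ y * t := by
  constructor
  · exact fun h => h ⟨1, hT.one_mem, by simp⟩
  · rintro ⟨t, ht, hxy⟩ z ⟨s, hs, hzx⟩
    exact ⟨t * s, hT.mul_mem t ht s hs, hzx.trans (by
      rw [← mul_assoc]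
      exact mul_le_mul_left hxy s)⟩

theorem IsPosConvex.lowerCoset_mono [MulRightMono L] {T : Set L} (hT : IsPosConvex T) {x y : L} (h : x ≤ y) :
    lowerCoset T x ⊆ lowerCoset T y :=
  hT.lowerCoset_subset_iff.2 ⟨1, hT.one_mem, by simpa using h⟩

/-- Left translation as an automorphism of the poset of lower cosets. -/
def lowerCosetHom [MulLeftMono L] (T : Set L) :
    L →* (Set.range (lowerCoset T) ≃o Set.range (lowerCoset T)) where
  toFun g :=
    { toFun := fun A => ⟨g • A.1, by
        obtain ⟨-, x, rfl⟩ := A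
        exact ⟨g * x, (smul_lowerCoset T g x).symm⟩⟩
      invFun := fun A => ⟨g⁻¹ • A.1, by
        obtain ⟨-, x, rfl⟩ := A
        exact ⟨g⁻¹ * x, (smul_lowerCoset T g⁻¹ x).symm⟩⟩
      left_inv := fun A => Subtype.ext (inv_smul_smul g A.1)
      right_inv := fun A => Subtype.ext (smul_inv_smul g A.1)
      map_rel_iff' := Set.smul_set_subset_smul_set_iff }
  map_one' := RelIso.ext fun A => Subtype.ext (one_smul L A.1)
  map_mul' g h := RelIso.ext fun A => Subtype.ext (mul_smul g h A.1)

theorem lowerCosetHom_apply [MulLeftMono L] (T : Set L) (g x : L) :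
    lowerCosetHom T g ⟨lowerCoset T x, x, rfl⟩ = ⟨lowerCoset T (g * x), g * x, rfl⟩ :=
  Subtype.ext (smul_lowerCoset T g x)

variable [MulLeftMono L] [MulRightMono L]

/-- The right side expands to the meet of `x * x`, `y * x`, `x * z` and `y * z`; positivity puts the
first three above `x`. -/
theorem inf_mul_le_inf_mul_inf {x y z : L} (hx : 1 ≤ x) (hy : 1 ≤ y) (hz : 1 ≤ z) :
    x ⊓ (y * z) ≤ (x ⊓ y) * (x ⊓ z) := by
  rw [mul_inf, inf_mul, inf_mul]
  refine le_inf (le_inf ?_ ?_) (le_inf ?_ inf_le_right)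
  · exact inf_le_left.trans (le_mul_of_one_le_left' hx)
  · exact inf_le_left.trans (le_mul_of_one_le_left' hy)
  · exact inf_le_left.trans (le_mul_of_one_le_right' hz)

/-- The convex submonoid of the positive cone generated by a convex one and a positive element. -/
def posConvexAdjoin (T : Set L) (a : L) : Set L :=
  {x | 1 ≤ x ∧ ∃ u ∈ Submonoid.closure (insert a T), x ≤ u}

theorem isPosConvex_posConvexAdjoin (T : Set L) (a : L) :
    IsPosConvex (posConvexAdjoin T a) where
  one_mem := ⟨le_rfl, 1, Submonoid.one_mem _, le_rfl⟩
  one_le _ hx := hx.1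
  mul_mem := fun _ ⟨hx, u, hu, hxu⟩ _ ⟨hy, v, hv, hyv⟩ =>
    ⟨one_le_mul hx hy, u * v, Submonoid.mul_mem _ hu hv, mul_le_mul' hxu hyv⟩
  mem_of_le := fun _ _ hx hxy ⟨_, u, hu, hyu⟩ => ⟨hx, u, hu, hxy.trans hyu⟩

/-- By `inf_mul_le_inf_mul_inf` and convexity, having a meet with a fixed positive element in `T`
passes to products of positive elements. This reduces the claim to generators, where it follows from
`a ⊓ b = 1` or convexity. -/
theorem IsPosConvex.inf_mem_of_mem_closure {T : Set L} (hT : IsPosConvex T) {a b : L}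
    (ha : 1 ≤ a) (hb : 1 ≤ b) (hab : a ⊓ b = 1) {u v : L}
    (hu : u ∈ Submonoid.closure (insert a T)) (hv : v ∈ Submonoid.closure (insert b T)) :
    u ⊓ v ∈ T := by
  have mul_right : ∀ {x y z : L}, 1 ≤ x → 1 ≤ y → 1 ≤ z → x ⊓ y ∈ T → x ⊓ z ∈ T →
      x ⊓ (y * z) ∈ T := fun hx hy hz hxy hxz =>
    hT.mem_of_le _ _ (le_inf hx (one_le_mul hy hz)) (inf_mul_le_inf_mul_inf hx hy hz)
      (hT.mul_mem _ hxy _ hxz)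
  have base : ∀ x ∈ insert a T, x ⊓ v ∈ T := by
    intro x hx
    have hx1 : 1 ≤ x := hx.elim (fun h => h ▸ ha) (hT.one_le x)
    induction hv using Submonoid.closure_induction with
    | mem y hy =>
      rcases hx with rfl | hx
      · rcases hy with rfl | hy
        · exact hab ▸ hT.one_mem
        · exact hT.mem_of_le _ _ (le_inf ha (hT.one_le y hy)) inf_le_right hy
      · have hy1 : 1 ≤ y := hy.elim (fun h => h ▸ hb) (hT.one_le y)
        exact hT.mem_of_le _ _ (le_inf hx1 hy1) inf_le_left hx
    | one => exact (inf_eq_right.2 hx1).symm ▸ hT.one_mem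
    | mul y z hy hz ihy ihz =>
      exact mul_right hx1 (hT.one_le_of_mem_closure hb hy) (hT.one_le_of_mem_closure hb hz) ihy ihz
  have hv1 := hT.one_le_of_mem_closure hb hv
  induction hu using Submonoid.closure_induction with
  | mem x hx => exact base x hx
  | one => exact (inf_eq_left.2 hv1).symm ▸ hT.one_mem
  | mul x y hx hy ihx ihy =>
    rw [inf_comm] at ihx ihy ⊢
    exact mul_right hv1 (hT.one_le_of_mem_closure ha hx) (hT.one_le_of_mem_closure ha hy) ihx ihy

/-- Every element `g > 1` is avoided by a convex submonoid of the positive cone which is prime. -/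
theorem exists_prime_isPosConvex {g : L} (hg : 1 < g) :
    ∃ T : Set L, IsPosConvex T ∧ g ∉ T ∧ ∀ a b : L, a ⊓ b = 1 → a ∈ T ∨ b ∈ T := by
  -- A `T` maximal among those avoiding `g` is prime: if both `a` and `b` were outside, adjoining
  -- either would capture `g`, and then `g` would lie below an element of `T`.
  obtain ⟨T, -, ⟨hT, hgT⟩, hmax⟩ := zorn_subset_nonempty
    {T : Set L | IsPosConvex T ∧ g ∉ T} (fun c hc hchain hne => by
      refine ⟨⋃₀ c, ⟨⟨?_, ?_, ?_, ?_⟩, ?_⟩, fun _ => Set.subset_sUnion_of_mem⟩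
      · obtain ⟨T, hT⟩ := hne
        exact ⟨T, hT, (hc hT).1.one_mem⟩
      · rintro x ⟨T, hT, hx⟩
        exact (hc hT).1.one_le x hx
      · rintro x ⟨T, hT, hx⟩ y ⟨T', hT', hy⟩
        rcases hchain.total hT hT' with h | h
        · exact ⟨T', hT', (hc hT').1.mul_mem x (h hx) y hy⟩
        · exact ⟨T, hT, (hc hT).1.mul_mem x hx y (h hy)⟩
      · rintro x y hx hxy ⟨T, hT, hy⟩
        exact ⟨T, hT, (hc hT).1.mem_of_le x y hx hxy hy⟩
      · rintro ⟨T, hT, hgT⟩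
        exact (hc hT).2 hgT)
    {1} ⟨⟨rfl, fun _ h => h.ge, fun _ hx _ hy => by simp_all,
      fun _ _ hx hxy hy => le_antisymm (hxy.trans hy.le) hx⟩, hg.ne'⟩
  refine ⟨T, hT, hgT, fun a b hab => ?_⟩
  have ha : 1 ≤ a := hab ▸ inf_le_left
  have hb : 1 ≤ b := hab ▸ inf_le_right
  have key : ∀ c : L, 1 ≤ c → c ∉ T → g ∈ posConvexAdjoin T c := by
    intro c hc hcT
    by_contra hgc
    have hsub : T ⊆ posConvexAdjoin T c := fun x hx =>
      ⟨hT.one_le x hx, x, Submonoid.subset_closure (Set.mem_insert_of_mem c hx), le_rfl⟩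
    exact hcT (hmax ⟨isPosConvex_posConvexAdjoin T c, hgc⟩ hsub
      ⟨hc, c, Submonoid.subset_closure (Set.mem_insert c T), le_rfl⟩)
  by_contra! h
  obtain ⟨-, u, hu, hgu⟩ := key a ha h.1
  obtain ⟨-, v, hv, hgv⟩ := key b hb h.2
  exact hgT (hT.mem_of_le _ _ hg.le (le_inf hgu hgv)
    (hT.inf_mem_of_mem_closure ha hb hab hu hv))

theorem IsPosConvex.lowerCoset_sup_of_subset {T : Set L} (hT : IsPosConvex T) {x y : L}
    (h : lowerCoset T x ⊆ lowerCoset T y) : lowerCoset T (x ⊔ y) = lowerCoset T y := by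
  obtain ⟨t, ht, hxy⟩ := hT.lowerCoset_subset_iff.1 h
  refine (hT.lowerCoset_subset_iff.2 ⟨t, ht, sup_le hxy ?_⟩).antisymm
    (hT.lowerCoset_mono le_sup_right)
  exact le_mul_of_one_le_right' (hT.one_le t ht)

theorem IsPosConvex.lowerCoset_inf_of_subset {T : Set L} (hT : IsPosConvex T) {x y : L}
    (h : lowerCoset T x ⊆ lowerCoset T y) : lowerCoset T (x ⊓ y) = lowerCoset T x := by
  obtain ⟨t, ht, hxy⟩ := hT.lowerCoset_subset_iff.1 h
  refine (hT.lowerCoset_mono inf_le_left).antisymm (hT.lowerCoset_subset_iff.2 ⟨t, ht, ?_⟩)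
  rw [inf_mul]
  exact le_inf (le_mul_of_one_le_right' (hT.one_le t ht)) hxy

/-- Dividing `x` and `y` by their meet leaves disjoint elements, one of which lies in `T` by
primeness; the cosets are therefore comparable. -/
theorem IsPosConvex.lowerCoset_total {T : Set L} (hT : IsPosConvex T)
    (hprime : ∀ a b : L, a ⊓ b = 1 → a ∈ T ∨ b ∈ T) (x y : L) :
    lowerCoset T x ⊆ lowerCoset T y ∨ lowerCoset T y ⊆ lowerCoset T x := by
  have hab : (x ⊓ y)⁻¹ * x ⊓ (x ⊓ y)⁻¹ * y = 1 := by rw [← mul_inf, inv_mul_cancel]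
  refine (hprime _ _ hab).imp (fun h => ?_) (fun h => ?_)
  · refine hT.lowerCoset_subset_iff.2 ⟨_, h, ?_⟩
    calc x = (x ⊓ y) * ((x ⊓ y)⁻¹ * x) := by simp
      _ ≤ _ := mul_le_mul_left inf_le_right _
  · refine hT.lowerCoset_subset_iff.2 ⟨_, h, ?_⟩
    calc y = (x ⊓ y) * ((x ⊓ y)⁻¹ * y) := by simp
      _ ≤ _ := mul_le_mul_left inf_le_left _

/-- Two distinct elements of a lattice-ordered group are separated by a homomorphism to the
lattice-ordered group of automorphisms of some chain. -/
theorem exists_hom_aut_chain_ne {g h : L} (hgh : g ≠ h) :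
    ∃ (Ω : Type u) (_ : LinearOrder Ω) (φ : L →* (Ω ≃o Ω)),
      (∀ a b, φ (a ⊔ b) = φ a ⊔ φ b) ∧ (∀ a b, φ (a ⊓ b) = φ a ⊓ φ b) ∧
        ∃ x, φ g x ≠ φ h x := by
  classical
  set k := g⁻¹ * h with hk
  have hk1 : k ≠ 1 := fun h1 => hgh (inv_mul_eq_one.1 h1)
  -- This element is strictly positive, as the choice of `T` requires, and any lattice homomorphism
  -- of groups killing `k` kills it too.
  have hpos : 1 < k ⊔ k⁻¹ ⊔ 1 := by
    refine lt_of_le_of_ne le_sup_right fun h1 => hk1 (le_antisymm ?_ ?_)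
    · rw [h1]
      exact le_sup_left.trans le_sup_left
    · rw [← inv_le_one', h1]
      exact le_sup_right.trans le_sup_left
  obtain ⟨T, hT, hgT, hprime⟩ := exists_prime_isPosConvex hpos
  let _ : LinearOrder (Set.range (lowerCoset T)) :=
    { (inferInstance : PartialOrder (Set.range (lowerCoset T))) with
      le_total := by
        rintro ⟨-, x, rfl⟩ ⟨-, y, rfl⟩
        exact hT.lowerCoset_total hprime x y
      toDecidableLE := Classical.decRel _ }
  have hsup : ∀ a b : L, lowerCosetHom T (a ⊔ b) = lowerCosetHom T a ⊔ lowerCosetHom T b := by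
    intro a b
    refine RelIso.ext fun A => ?_
    obtain ⟨-, x, rfl⟩ := A
    rw [OrderIso.aut_sup_apply]
    simp only [lowerCosetHom_apply, sup_mul]
    rcases hT.lowerCoset_total hprime (a * x) (b * x) with h | h
    · rw [max_eq_right (by exact h)]
      exact Subtype.ext (hT.lowerCoset_sup_of_subset h)
    · rw [max_eq_left (by exact h)]
      refine Subtype.ext (Eq.trans ?_ (hT.lowerCoset_sup_of_subset h))
      exact congrArg (lowerCoset T) (sup_comm _ _)
  have hinf : ∀ a b : L, lowerCosetHom T (a ⊓ b) = lowerCosetHom T a ⊓ lowerCosetHom T b := by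
    intro a b
    refine RelIso.ext fun A => ?_
    obtain ⟨-, x, rfl⟩ := A
    rw [OrderIso.aut_inf_apply]
    simp only [lowerCosetHom_apply, inf_mul]
    rcases hT.lowerCoset_total hprime (a * x) (b * x) with h | h
    · rw [min_eq_left (by exact h)]
      exact Subtype.ext (hT.lowerCoset_inf_of_subset h)
    · rw [min_eq_right (by exact h)]
      refine Subtype.ext (Eq.trans ?_ (hT.lowerCoset_inf_of_subset h))
      exact congrArg (lowerCoset T) (inf_comm _ _)
  refine ⟨Set.range (lowerCoset T), inferInstance, lowerCosetHom T, hsup, hinf, ?_⟩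
  by_contra! hx
  apply hgT
  have hφ : lowerCosetHom T k = 1 := by
    rw [hk, map_mul, map_inv, inv_mul_eq_one]
    exact RelIso.ext hx
  have h1 : lowerCosetHom T (k ⊔ k⁻¹ ⊔ 1) = 1 := by
    rw [hsup, hsup, map_inv, hφ, map_one, inv_one, sup_idem, sup_idem]
  -- Acting trivially on the coset of `1` would put the positive element below some `t ∈ T`, hence
  -- in `T`.
  have h2 := congrArg Subtype.val
    (DFunLike.congr_fun h1 (⟨lowerCoset T 1, 1, rfl⟩ : Set.range (lowerCoset T)))
  rw [lowerCosetHom_apply] at h2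
  obtain ⟨t, ht, hle⟩ := hT.lowerCoset_subset_iff.1 h2.subset
  rw [mul_one, one_mul] at hle
  exact hT.mem_of_le _ _ hpos.le hle ht

end Representation

/-! ### Evaluation tables -/

/-- A table of evaluations on the points `0, …, B - 1` of a finite chain. `E c 1 i j` says that the
term with code `c` sends `i` to `j`, and `E c 0 i j` that its inverse does; every entry for a
compound term has to be justified by entries for its immediate subterms, and the entries for a
variable form a partial isomorphism. -/
structure IsEvalTable (B : ℕ) (E : ℕ → ℕ → ℕ → ℕ → Prop) : Prop where
  one_pos : ∀ i < B, ∀ j < B, E 0 1 i j → i = j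
  one_neg : ∀ i < B, ∀ j < B, E 0 0 i j → i = j
  var_pos : ∀ n < B, ∀ i < B, ∀ j < B, ∀ i' < B, ∀ j' < B,
    E (5 * n + 1) 1 i j → E (5 * n + 1) 1 i' j' → (i < i' ↔ j < j')
  var_neg : ∀ n < B, ∀ i < B, ∀ j < B, E (5 * n + 1) 0 i j → E (5 * n + 1) 1 j i
  inv_pos : ∀ k < B, ∀ i < B, ∀ j < B, E (5 * k + 1 + 1) 1 i j → E k 0 i j
  inv_neg : ∀ k < B, ∀ i < B, ∀ j < B, E (5 * k + 1 + 1) 0 i j → E k 1 i j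
  mul_pos : ∀ k < B, ∀ l < B, ∀ i < B, ∀ j < B, E (5 * Nat.pair k l + 2 + 1) 1 i j →
    ∃ z < B, E l 1 i z ∧ E k 1 z j
  mul_neg : ∀ k < B, ∀ l < B, ∀ i < B, ∀ j < B, E (5 * Nat.pair k l + 2 + 1) 0 i j →
    ∃ z < B, E k 0 i z ∧ E l 0 z j
  inf_pos : ∀ k < B, ∀ l < B, ∀ i < B, ∀ j < B, E (5 * Nat.pair k l + 3 + 1) 1 i j →
    ∃ y < B, ∃ z < B, (E k 1 i y ∧ E l 1 i z) ∧ j = min y z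
  inf_neg : ∀ k < B, ∀ l < B, ∀ i < B, ∀ j < B, E (5 * Nat.pair k l + 3 + 1) 0 i j →
    ∃ y < B, ∃ z < B, (E k 0 i y ∧ E l 0 i z) ∧ j = max y z
  sup_pos : ∀ k < B, ∀ l < B, ∀ i < B, ∀ j < B, E (5 * Nat.pair k l + 4 + 1) 1 i j →
    ∃ y < B, ∃ z < B, (E k 1 i y ∧ E l 1 i z) ∧ j = max y z
  sup_neg : ∀ k < B, ∀ l < B, ∀ i < B, ∀ j < B, E (5 * Nat.pair k l + 4 + 1) 0 i j →
    ∃ y < B, ∃ z < B, (E k 0 i y ∧ E l 0 i z) ∧ j = min y z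

theorem Nat.lt_of_five_mul_pair_add_lt {k l r B : ℕ} (h : 5 * Nat.pair k l + r < B) :
    k < B ∧ l < B := by
  have := Nat.left_le_pair k l
  have := Nat.right_le_pair k l
  omega

namespace LGroupTerm

theorem eval_map {L M : Type*} [Lattice L] [Group L] [Lattice M] [Group M] (φ : L →* M)
    (hsup : ∀ a b, φ (a ⊔ b) = φ a ⊔ φ b) (hinf : ∀ a b, φ (a ⊓ b) = φ a ⊓ φ b)
    (v : ℕ → L) (t : LGroupTerm) : φ (t.eval v) = t.eval (fun n => φ (v n)) := by
  induction t with
  | var n => rfl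
  | one => exact map_one φ
  | inv t ih => simp only [eval, map_inv, ih]
  | mul s t ihs iht => simp only [eval, map_mul, ihs, iht]
  | inf s t ihs iht => simp only [eval, hinf, ihs, iht]
  | sup s t ihs iht => simp only [eval, hsup, ihs, iht]

end LGroupTerm

/-! ### From a table to automorphisms of a dense chain -/

section Soundness

variable {Ω : Type*} [LinearOrder Ω] {B : ℕ} {E : ℕ → ℕ → ℕ → ℕ → Prop}

/-- The entries for a variable in an evaluation table are realized by an automorphism of any
countable dense chain without endpoints in which the points are placed. -/
theorem IsEvalTable.exists_aut [Countable Ω] [DenselyOrdered Ω] [NoMinOrder Ω] [NoMaxOrder Ω]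
    [Nonempty Ω] (hE : IsEvalTable B E) {ι : ℕ → Ω} (hι : StrictMono ι) {n : ℕ} (hn : n < B) :
    ∃ f : Ω ≃o Ω, ∀ i < B, ∀ j < B, E (5 * n + 1) 1 i j → f (ι i) = ι j := by
  classical
  let A : Finset (ℕ × ℕ) :=
    {q ∈ Finset.range B ×ˢ Finset.range B | E (5 * n + 1) 1 q.1 q.2}
  have hA : ∀ q ∈ A, q.1 < B ∧ q.2 < B ∧ E (5 * n + 1) 1 q.1 q.2 := by
    intro q hq
    simpa [A, and_assoc] using hq
  obtain ⟨f, hf⟩ := Order.PartialIso.exists_orderIso_extension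
    (⟨A.image (Prod.map ι ι), fun p hp q hq => by
      obtain ⟨p, hpA, rfl⟩ := Finset.mem_image.1 hp
      obtain ⟨q, hqA, rfl⟩ := Finset.mem_image.1 hq
      obtain ⟨hp1, hp2, hpE⟩ := hA p hpA
      obtain ⟨hq1, hq2, hqE⟩ := hA q hqA
      have hpq := hE.var_pos n hn _ hp1 _ hp2 _ hq1 _ hq2 hpE hqE
      have hqp := hE.var_pos n hn _ hq1 _ hq2 _ hp1 _ hp2 hqE hpE
      simp only [Prod.map_fst, Prod.map_snd, hι.cmp_map_eq]
      rcases lt_trichotomy p.1 q.1 with h | h | h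
      · rw [h.cmp_eq_lt, (hpq.1 h).cmp_eq_lt]
      · have : p.2 = q.2 := by omega
        rw [h.cmp_eq_eq, this.cmp_eq_eq]
      · rw [h.cmp_eq_gt, (hqp.1 h).cmp_eq_gt]⟩ : Order.PartialIso Ω Ω)
  refine ⟨f, fun i hi j hj hij => hf (ι i, ι j) (Finset.mem_image.2 ⟨(i, j), ?_, rfl⟩)⟩
  simp [A, hi, hj, hij]

/-- Entries are justified by entries for subterms, so structural induction applies; both polarities
are proved together because `inv` exchanges them. Missing entries assert nothing, so no totality is
needed. -/
theorem IsEvalTable.eval_apply (hE : IsEvalTable B E) {ι : ℕ → Ω} (hι : StrictMono ι)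
    {v : ℕ → (Ω ≃o Ω)}
    (hv : ∀ n < B, ∀ i < B, ∀ j < B, E (5 * n + 1) 1 i j → v n (ι i) = ι j)
    (t : LGroupTerm) (ht : t.toCode < B) : ∀ i < B, ∀ j < B,
      (E t.toCode 1 i j → t.eval v (ι i) = ι j) ∧
      (E t.toCode 0 i j → (t.eval v)⁻¹ (ι i) = ι j) := by
  induction t with
  | var n =>
    rw [LGroupTerm.toCode] at ht ⊢
    have hn : n < B := by omega
    refine fun i hi j hj => ⟨hv n hn i hi j hj, fun h => ?_⟩
    rw [LGroupTerm.eval, ← hv n hn j hj i hi (hE.var_neg n hn i hi j hj h), RelIso.inv_apply_self]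
  | one =>
    rw [LGroupTerm.toCode]
    refine fun i hi j hj => ⟨fun h => ?_, fun h => ?_⟩
    · rw [hE.one_pos i hi j hj h]
      rfl
    · rw [hE.one_neg i hi j hj h]
      rfl
  | inv t ih =>
    rw [LGroupTerm.toCode] at ht ⊢
    have hk : t.toCode < B := by omega
    refine fun i hi j hj => ⟨fun h => ?_, fun h => ?_⟩
    · exact (ih hk i hi j hj).2 (hE.inv_pos _ hk i hi j hj h)
    · rw [LGroupTerm.eval, inv_inv]
      exact (ih hk i hi j hj).1 (hE.inv_neg _ hk i hi j hj h)
  | mul s t ihs iht =>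
    rw [LGroupTerm.toCode] at ht ⊢
    obtain ⟨hk, hl⟩ := Nat.lt_of_five_mul_pair_add_lt ht
    refine fun i hi j hj => ⟨fun h => ?_, fun h => ?_⟩
    · obtain ⟨z, hz, h1, h2⟩ := hE.mul_pos _ hk _ hl i hi j hj h
      rw [LGroupTerm.eval, RelIso.mul_apply, (iht hl i hi z hz).1 h1, (ihs hk z hz j hj).1 h2]
    · obtain ⟨z, hz, h1, h2⟩ := hE.mul_neg _ hk _ hl i hi j hj h
      rw [LGroupTerm.eval, mul_inv_rev, RelIso.mul_apply, (ihs hk i hi z hz).2 h1,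
        (iht hl z hz j hj).2 h2]
  | inf s t ihs iht =>
    rw [LGroupTerm.toCode] at ht ⊢
    obtain ⟨hk, hl⟩ := Nat.lt_of_five_mul_pair_add_lt ht
    refine fun i hi j hj => ⟨fun h => ?_, fun h => ?_⟩
    · obtain ⟨y, hy, z, hz, ⟨h1, h2⟩, rfl⟩ := hE.inf_pos _ hk _ hl i hi j hj h
      rw [LGroupTerm.eval, OrderIso.aut_inf_apply, (ihs hk i hi y hy).1 h1,
        (iht hl i hi z hz).1 h2, hι.monotone.map_min]
    · obtain ⟨y, hy, z, hz, ⟨h1, h2⟩, rfl⟩ := hE.inf_neg _ hk _ hl i hi j hj h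
      rw [LGroupTerm.eval, inv_inf, OrderIso.aut_sup_apply, (ihs hk i hi y hy).2 h1,
        (iht hl i hi z hz).2 h2, hι.monotone.map_max]
  | sup s t ihs iht =>
    rw [LGroupTerm.toCode] at ht ⊢
    obtain ⟨hk, hl⟩ := Nat.lt_of_five_mul_pair_add_lt ht
    refine fun i hi j hj => ⟨fun h => ?_, fun h => ?_⟩
    · obtain ⟨y, hy, z, hz, ⟨h1, h2⟩, rfl⟩ := hE.sup_pos _ hk _ hl i hi j hj h
      rw [LGroupTerm.eval, OrderIso.aut_sup_apply, (ihs hk i hi y hy).1 h1,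
        (iht hl i hi z hz).1 h2, hι.monotone.map_max]
    · obtain ⟨y, hy, z, hz, ⟨h1, h2⟩, rfl⟩ := hE.sup_neg _ hk _ hl i hi j hj h
      rw [LGroupTerm.eval, inv_sup, OrderIso.aut_inf_apply, (ihs hk i hi y hy).2 h1,
        (iht hl i hi z hz).2 h2, hι.monotone.map_min]

end Soundness

/-! ### From a computation on a chain to a table -/

section Completeness

variable {Ω : Type*} [LinearOrder Ω]

namespace LGroupTerm

/-- `t.Sends v S b x y` says that the automorphism denoted by `t` (for `b = 1`) or its inverse
(for `b = 0`) sends `x` to `y`, all intermediate points of the computation being in `S`. -/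
def Sends (v : ℕ → (Ω ≃o Ω)) (S : Finset Ω) : LGroupTerm → ℕ → Ω → Ω → Prop
  | var n, 0, x, y => v n y = x
  | var n, _ + 1, x, y => v n x = y
  | one, _, x, y => x = y
  | inv t, 0, x, y => t.Sends v S 1 x y
  | inv t, _ + 1, x, y => t.Sends v S 0 x y
  | mul s t, 0, x, y => ∃ z ∈ S, s.Sends v S 0 x z ∧ t.Sends v S 0 z y
  | mul s t, _ + 1, x, y => ∃ z ∈ S, t.Sends v S 1 x z ∧ s.Sends v S 1 z y
  | inf s t, 0, x, w => ∃ y ∈ S, ∃ z ∈ S, s.Sends v S 0 x y ∧ t.Sends v S 0 x z ∧ w = max y z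
  | inf s t, _ + 1, x, w => ∃ y ∈ S, ∃ z ∈ S, s.Sends v S 1 x y ∧ t.Sends v S 1 x z ∧ w = min y z
  | sup s t, 0, x, w => ∃ y ∈ S, ∃ z ∈ S, s.Sends v S 0 x y ∧ t.Sends v S 0 x z ∧ w = min y z
  | sup s t, _ + 1, x, w => ∃ y ∈ S, ∃ z ∈ S, s.Sends v S 1 x y ∧ t.Sends v S 1 x z ∧ w = max y z

open Classical in
/-- The computation of the value at a point of the automorphism denoted by a term, or of its
inverse, visits at most as many new points as the code of the term tells. -/
theorem exists_finset_sends (v : ℕ → (Ω ≃o Ω)) (t : LGroupTerm) : ∀ x : Ω,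
    (∃ S₀ : Finset Ω, S₀.card ≤ t.toCode ∧ ∀ S, S₀ ⊆ S → x ∈ S →
      t.eval v x ∈ S ∧ t.Sends v S 1 x (t.eval v x)) ∧
    (∃ S₀ : Finset Ω, S₀.card ≤ t.toCode ∧ ∀ S, S₀ ⊆ S → x ∈ S →
      (t.eval v)⁻¹ x ∈ S ∧ t.Sends v S 0 x ((t.eval v)⁻¹ x)) := by
  -- `Nat.pair` dominates both of its arguments, so the code of a compound term exceeds the sum of
  -- the codes of its two subterms.
  have hcard : ∀ {s t : LGroupTerm} {S₁ S₂ : Finset Ω} (r : ℕ), S₁.card ≤ s.toCode →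
      S₂.card ≤ t.toCode → (S₁ ∪ S₂).card ≤ 5 * Nat.pair s.toCode t.toCode + r + 1 := by
    intro s t S₁ S₂ r h₁ h₂
    have := Finset.card_union_le S₁ S₂
    have := Nat.left_le_pair s.toCode t.toCode
    have := Nat.right_le_pair s.toCode t.toCode
    omega
  induction t with
  | var n =>
    refine fun x => ⟨⟨{v n x}, by simp [toCode], fun S hS _ => ?_⟩,
      ⟨{(v n)⁻¹ x}, by simp [toCode], fun S hS _ => ?_⟩⟩
    · exact ⟨hS (Finset.mem_singleton_self _), rfl⟩
    · exact ⟨hS (Finset.mem_singleton_self _), RelIso.apply_inv_self (v n) x⟩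
  | one =>
    exact fun x => ⟨⟨∅, by simp, fun S _ hx => ⟨hx, rfl⟩⟩, ⟨∅, by simp, fun S _ hx => ⟨hx, rfl⟩⟩⟩
  | inv t ih =>
    intro x
    obtain ⟨⟨S₁, h₁, H₁⟩, ⟨S₂, h₂, H₂⟩⟩ := ih x
    refine ⟨⟨S₂, by rw [toCode]; omega, fun S hS hx => H₂ S hS hx⟩,
      ⟨S₁, by rw [toCode]; omega, fun S hS hx => ?_⟩⟩
    rw [eval, inv_inv]
    exact H₁ S hS hx
  | mul s t ihs iht =>
    intro x
    constructor
    · obtain ⟨S₁, h₁, H₁⟩ := (iht x).1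
      obtain ⟨S₂, h₂, H₂⟩ := (ihs (t.eval v x)).1
      refine ⟨S₂ ∪ S₁, hcard 2 h₂ h₁, fun S hS hx => ?_⟩
      obtain ⟨hy, Hy⟩ := H₁ S (Finset.union_subset_right hS) hx
      obtain ⟨hz, Hz⟩ := H₂ S (Finset.union_subset_left hS) hy
      exact ⟨hz, _, hy, Hy, Hz⟩
    · obtain ⟨S₁, h₁, H₁⟩ := (ihs x).2
      obtain ⟨S₂, h₂, H₂⟩ := (iht ((s.eval v)⁻¹ x)).2
      refine ⟨S₁ ∪ S₂, hcard 2 h₁ h₂, fun S hS hx => ?_⟩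
      obtain ⟨hy, Hy⟩ := H₁ S (Finset.union_subset_left hS) hx
      obtain ⟨hz, Hz⟩ := H₂ S (Finset.union_subset_right hS) hy
      rw [eval, mul_inv_rev, RelIso.mul_apply]
      exact ⟨hz, _, hy, Hy, Hz⟩
  | inf s t ihs iht =>
    intro x
    constructor
    · obtain ⟨S₁, h₁, H₁⟩ := (ihs x).1
      obtain ⟨S₂, h₂, H₂⟩ := (iht x).1
      refine ⟨S₁ ∪ S₂, hcard 3 h₁ h₂, fun S hS hx => ?_⟩
      obtain ⟨hy, Hy⟩ := H₁ S (Finset.union_subset_left hS) hx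
      obtain ⟨hz, Hz⟩ := H₂ S (Finset.union_subset_right hS) hx
      rw [eval, OrderIso.aut_inf_apply]
      exact ⟨min_rec' (· ∈ S) hy hz, _, hy, _, hz, Hy, Hz, rfl⟩
    · obtain ⟨S₁, h₁, H₁⟩ := (ihs x).2
      obtain ⟨S₂, h₂, H₂⟩ := (iht x).2
      refine ⟨S₁ ∪ S₂, hcard 3 h₁ h₂, fun S hS hx => ?_⟩
      obtain ⟨hy, Hy⟩ := H₁ S (Finset.union_subset_left hS) hx
      obtain ⟨hz, Hz⟩ := H₂ S (Finset.union_subset_right hS) hx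
      rw [eval, inv_inf, OrderIso.aut_sup_apply]
      exact ⟨max_rec' (· ∈ S) hy hz, _, hy, _, hz, Hy, Hz, rfl⟩
  | sup s t ihs iht =>
    intro x
    constructor
    · obtain ⟨S₁, h₁, H₁⟩ := (ihs x).1
      obtain ⟨S₂, h₂, H₂⟩ := (iht x).1
      refine ⟨S₁ ∪ S₂, hcard 4 h₁ h₂, fun S hS hx => ?_⟩
      obtain ⟨hy, Hy⟩ := H₁ S (Finset.union_subset_left hS) hx
      obtain ⟨hz, Hz⟩ := H₂ S (Finset.union_subset_right hS) hx
      rw [eval, OrderIso.aut_sup_apply]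
      exact ⟨max_rec' (· ∈ S) hy hz, _, hy, _, hz, Hy, Hz, rfl⟩
    · obtain ⟨S₁, h₁, H₁⟩ := (ihs x).2
      obtain ⟨S₂, h₂, H₂⟩ := (iht x).2
      refine ⟨S₁ ∪ S₂, hcard 4 h₁ h₂, fun S hS hx => ?_⟩
      obtain ⟨hy, Hy⟩ := H₁ S (Finset.union_subset_left hS) hx
      obtain ⟨hz, Hz⟩ := H₂ S (Finset.union_subset_right hS) hx
      rw [eval, inv_sup, OrderIso.aut_inf_apply]
      exact ⟨min_rec' (· ∈ S) hy hz, _, hy, _, hz, Hy, Hz, rfl⟩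

end LGroupTerm

/-! ### Ranks in a finite subset of a chain -/

namespace Finset

/-- The number of elements of a finite set lying strictly below a point. -/
def rankIn (S : Finset Ω) (x : Ω) : ℕ := {z ∈ S | z < x}.card

theorem rankIn_mono (S : Finset Ω) : Monotone S.rankIn := fun _ _ h =>
  card_le_card (monotone_filter_right S fun _ _ hz => lt_of_lt_of_le hz h)

/-- Only the smaller point must lie in `S`: it is counted below `y` but not below itself. -/
theorem rankIn_lt_rankIn_iff {S : Finset Ω} {x y : Ω} (hx : x ∈ S) :
    S.rankIn x < S.rankIn y ↔ x < y := by
  refine ⟨fun h => lt_of_not_ge fun hyx => h.not_ge (S.rankIn_mono hyx), fun h => ?_⟩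
  refine card_lt_card ⟨monotone_filter_right S fun _ _ hz => lt_trans hz h, fun hsub => ?_⟩
  exact lt_irrefl x (mem_filter.1 (hsub (mem_filter.2 ⟨hx, h⟩))).2

theorem rankIn_lt_card {S : Finset Ω} {x : Ω} (hx : x ∈ S) : S.rankIn x < S.card :=
  card_lt_card ⟨filter_subset _ S, fun hsub => lt_irrefl x (mem_filter.1 (hsub hx)).2⟩

theorem rankIn_injOn (S : Finset Ω) : Set.InjOn S.rankIn S := fun _ hx _ hy h =>
  le_antisymm (not_lt.1 fun hlt => h.not_gt ((rankIn_lt_rankIn_iff hy).2 hlt))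
    (not_lt.1 fun hlt => h.not_lt ((rankIn_lt_rankIn_iff hx).2 hlt))

end Finset

/-- The table of the computations that stay in `S`, its points being numbered in their order. -/
def sendsTable (v : ℕ → (Ω ≃o Ω)) (S : Finset Ω) (B c b i j : ℕ) : Prop :=
  (c < B ∧ b < 2) ∧ ∃ x ∈ S, ∃ y ∈ S, S.rankIn x = i ∧ S.rankIn y = j ∧
    (LGroupTerm.ofCode c).Sends v S b x y

theorem sendsTable_toCode_iff {v : ℕ → (Ω ≃o Ω)} {S : Finset Ω} {B b i j : ℕ} {t : LGroupTerm} :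
    sendsTable v S B t.toCode b i j ↔ (t.toCode < B ∧ b < 2) ∧ ∃ x ∈ S, ∃ y ∈ S,
      S.rankIn x = i ∧ S.rankIn y = j ∧ t.Sends v S b x y := by
  rw [sendsTable, LGroupTerm.ofCode_toCode]

/-- Each table condition is a clause of `Sends` read through the rank, which is strictly monotone on
`S`; the cardinality bound keeps the witnesses below `B`. -/
theorem isEvalTable_sendsTable (v : ℕ → (Ω ≃o Ω)) {S : Finset Ω} {B : ℕ} (hS : S.card ≤ B) :
    IsEvalTable B (sendsTable v S B) := by
  have hrank : ∀ {x}, x ∈ S → S.rankIn x < B := fun hx =>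
    (Finset.rankIn_lt_card hx).trans_le hS
  have hvar : ∀ n, 5 * n + 1 = (LGroupTerm.var n).toCode := fun _ => rfl
  have hone : 0 = LGroupTerm.one.toCode := rfl
  have hinv : ∀ t, 5 * LGroupTerm.toCode t + 1 + 1 = (LGroupTerm.inv t).toCode := fun _ => rfl
  have hmul : ∀ s t, 5 * Nat.pair (LGroupTerm.toCode s) (LGroupTerm.toCode t) + 2 + 1 =
    (LGroupTerm.mul s t).toCode := fun _ _ => rfl
  have hinf : ∀ s t, 5 * Nat.pair (LGroupTerm.toCode s) (LGroupTerm.toCode t) + 3 + 1 =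
    (LGroupTerm.inf s t).toCode := fun _ _ => rfl
  have hsup : ∀ s t, 5 * Nat.pair (LGroupTerm.toCode s) (LGroupTerm.toCode t) + 4 + 1 =
    (LGroupTerm.sup s t).toCode := fun _ _ => rfl
  -- Every number is a code, so the numerical parameters of the conditions may be replaced by terms.
  have hcode : ∀ k, ∃ t : LGroupTerm, t.toCode = k := fun k => ⟨_, LGroupTerm.toCode_ofCode k⟩
  constructor
  · intro i _ j _ h
    rw [hone, sendsTable_toCode_iff] at h
    obtain ⟨-, _, _, _, _, rfl, rfl, rfl⟩ := h
    rfl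
  · intro i _ j _ h
    rw [hone, sendsTable_toCode_iff] at h
    obtain ⟨-, _, _, _, _, rfl, rfl, rfl⟩ := h
    rfl
  · intro n _ i _ j _ i' _ j' _ h h'
    rw [hvar, sendsTable_toCode_iff] at h h'
    obtain ⟨-, x, hx, _, hy, rfl, rfl, rfl⟩ := h
    obtain ⟨-, x', hx', _, hy', rfl, rfl, rfl⟩ := h'
    rw [Finset.rankIn_lt_rankIn_iff hx, Finset.rankIn_lt_rankIn_iff hy, (v n).lt_iff_lt]
  · intro n _ i _ j _ h
    rw [hvar, sendsTable_toCode_iff] at h ⊢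
    obtain ⟨⟨hB, -⟩, x, hx, y, hy, hi, hj, h⟩ := h
    exact ⟨⟨hB, by omega⟩, y, hy, x, hx, hj, hi, h⟩
  · intro k hk i _ j _ h
    obtain ⟨t, rfl⟩ := hcode k
    rw [hinv, sendsTable_toCode_iff] at h
    obtain ⟨-, x, hx, y, hy, hi, hj, h⟩ := h
    exact sendsTable_toCode_iff.2 ⟨⟨hk, by omega⟩, x, hx, y, hy, hi, hj, h⟩
  · intro k hk i _ j _ h
    obtain ⟨t, rfl⟩ := hcode k
    rw [hinv, sendsTable_toCode_iff] at h
    obtain ⟨-, x, hx, y, hy, hi, hj, h⟩ := h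
    exact sendsTable_toCode_iff.2 ⟨⟨hk, by omega⟩, x, hx, y, hy, hi, hj, h⟩
  · intro k hk l hl i _ j _ h
    obtain ⟨s, rfl⟩ := hcode k
    obtain ⟨t, rfl⟩ := hcode l
    rw [hmul, sendsTable_toCode_iff] at h
    obtain ⟨-, x, hx, y, hy, hi, hj, z, hz, h₁, h₂⟩ := h
    exact ⟨S.rankIn z, hrank hz,
      sendsTable_toCode_iff.2 ⟨⟨hl, by omega⟩, x, hx, z, hz, hi, rfl, h₁⟩,
      sendsTable_toCode_iff.2 ⟨⟨hk, by omega⟩, z, hz, y, hy, rfl, hj, h₂⟩⟩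
  · intro k hk l hl i _ j _ h
    obtain ⟨s, rfl⟩ := hcode k
    obtain ⟨t, rfl⟩ := hcode l
    rw [hmul, sendsTable_toCode_iff] at h
    obtain ⟨-, x, hx, y, hy, hi, hj, z, hz, h₁, h₂⟩ := h
    exact ⟨S.rankIn z, hrank hz,
      sendsTable_toCode_iff.2 ⟨⟨hk, by omega⟩, x, hx, z, hz, hi, rfl, h₁⟩,
      sendsTable_toCode_iff.2 ⟨⟨hl, by omega⟩, z, hz, y, hy, rfl, hj, h₂⟩⟩
  all_goals
    intro k hk l hl i _ j _ h
    obtain ⟨s, rfl⟩ := hcode k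
    obtain ⟨t, rfl⟩ := hcode l
    first | rw [hinf, sendsTable_toCode_iff] at h | rw [hsup, sendsTable_toCode_iff] at h
    obtain ⟨-, x, hx, w, hw, hi, hj, y, hy, z, hz, h₁, h₂, rfl⟩ := h
    refine ⟨S.rankIn y, hrank hy, S.rankIn z, hrank hz,
      ⟨sendsTable_toCode_iff.2 ⟨⟨hk, by omega⟩, x, hx, y, hy, hi, rfl, h₁⟩,
      sendsTable_toCode_iff.2 ⟨⟨hl, by omega⟩, x, hx, z, hz, hi, rfl, h₂⟩⟩, ?_⟩
    rw [← hj]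
    first | exact S.rankIn_mono.map_min | exact S.rankIn_mono.map_max

end Completeness

/-! ### Tables coded by numbers -/

/-- The table whose entries are the binary digits of `m`. -/
def bitTable (m c b i j : ℕ) : Prop :=
  m / 2 ^ Nat.pair (Nat.pair c b) (Nat.pair i j) % 2 = 1

/-- A bound for the positions of the entries of a table of size `B`. -/
def bitTableLength (B : ℕ) : ℕ := Nat.pair (Nat.pair B 2) (Nat.pair B B)

/-- `Nat.pair` is strictly monotone in each argument, so every possible entry has its digit position
below `bitTableLength B`. -/
theorem exists_bitTable_iff (B : ℕ) (E : ℕ → ℕ → ℕ → ℕ → Prop)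
    (hE : ∀ c b i j, E c b i j → c < B ∧ b < 2 ∧ i < B ∧ j < B) :
    ∃ m < 2 ^ bitTableLength B, ∀ c b i j, bitTable m c b i j ↔ E c b i j := by
  classical
  let f : Fin (bitTableLength B) → Bool := fun p => decide
    (E p.1.unpair.1.unpair.1 p.1.unpair.1.unpair.2 p.1.unpair.2.unpair.1 p.1.unpair.2.unpair.2)
  refine ⟨Nat.ofBits f, Nat.ofBits_lt_two_pow f, fun c b i j => ?_⟩
  have hbit : bitTable (Nat.ofBits f) c b i j ↔
      (Nat.ofBits f).testBit (Nat.pair (Nat.pair c b) (Nat.pair i j)) = true := by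
    rw [bitTable, Nat.testBit_eq_decide_div_mod_eq, decide_eq_true_iff]
  rw [hbit, Nat.testBit_ofBits]
  split_ifs with hlt
  · simp [f]
  · simp only [false_iff]
    intro h
    obtain ⟨hc, hb, hi, hj⟩ := hE c b i j h
    refine hlt ((Nat.pair_lt_pair_left _ ?_).trans (Nat.pair_lt_pair_right _ ?_))
    · exact (Nat.pair_lt_pair_left _ hc).trans (Nat.pair_lt_pair_right _ hb)
    · exact (Nat.pair_lt_pair_left _ hi).trans (Nat.pair_lt_pair_right _ hj)

/-! ### Invalidity as the existence of a bounded refutation -/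

/-- The digits of `m` form an evaluation table of size `B` in which the terms with codes `c` and `d`
send some point to different points. -/
def IsRefutation (B c d m : ℕ) : Prop :=
  IsEvalTable B (bitTable m) ∧
    ∃ i < B, ∃ j < B, ∃ k < B, (bitTable m c 1 i j ∧ bitTable m d 1 i k) ∧ ¬ j = k

theorem not_validInLGroups_of_isRefutation {s t : LGroupTerm} {B m : ℕ} (hs : s.toCode < B)
    (ht : t.toCode < B) (h : IsRefutation B s.toCode t.toCode m) :
    ¬ ValidInLGroups.{u} s t := by
  obtain ⟨hE, i, hi, j, hj, k, hk, ⟨h₁, h₂⟩, hjk⟩ := h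
  -- Lifting `ℚ` puts its automorphism group in the universe over which validity quantifies.
  let e : ULift.{u} ℚ ≃o ℚ := { Equiv.ulift with map_rel_iff' := Iff.rfl }
  have : DenselyOrdered (ULift.{u} ℚ) :=
    ⟨fun _ _ h => (exists_between (α := ℚ) h).imp' ULift.up fun _ h => h⟩
  have : NoMinOrder (ULift.{u} ℚ) := ⟨fun x => (exists_lt x.down).imp' ULift.up fun _ h => h⟩
  have : NoMaxOrder (ULift.{u} ℚ) := ⟨fun x => (exists_gt x.down).imp' ULift.up fun _ h => h⟩
  have hι : StrictMono fun n : ℕ => e.symm n := e.symm.strictMono.comp Nat.strictMono_cast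
  have hex : ∀ n, ∃ f : ULift.{u} ℚ ≃o ULift.{u} ℚ, n < B → ∀ i < B, ∀ j < B,
      bitTable m (5 * n + 1) 1 i j → f (e.symm i) = e.symm j := by
    intro n
    by_cases hn : n < B
    · obtain ⟨f, hf⟩ := hE.exists_aut hι hn
      exact ⟨f, fun _ => hf⟩
    -- Variables with index at least `B` are unconstrained, so any automorphism serves.
    · exact ⟨1, fun h => (hn h).elim⟩
  choose v hv using hex
  intro hvalid
  have h := hvalid (ULift.{u} ℚ ≃o ULift.{u} ℚ) v
  have e₁ := (hE.eval_apply hι hv s hs i hi j hj).1 h₁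
  have e₂ := (hE.eval_apply hι hv t ht i hi k hk).1 h₂
  rw [← h, e₁] at e₂
  exact hjk (hι.injective e₂)

theorem exists_isRefutation_of_not_validInLGroups {s t : LGroupTerm}
    (h : ¬ ValidInLGroups.{u} s t) :
    ∃ m < 2 ^ bitTableLength (s.toCode + t.toCode + 1),
      IsRefutation (s.toCode + t.toCode + 1) s.toCode t.toCode m := by
  classical
  simp only [ValidInLGroups, not_forall] at h
  obtain ⟨L, _, _, _, _, v, hne⟩ := h
  obtain ⟨Ω, _, φ, hsup, hinf, x, hx⟩ := exists_hom_aut_chain_ne hne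
  rw [LGroupTerm.eval_map φ hsup hinf, LGroupTerm.eval_map φ hsup hinf] at hx
  set w : ℕ → (Ω ≃o Ω) := fun n => φ (v n)
  obtain ⟨S₁, h₁, H₁⟩ := (s.exists_finset_sends w x).1
  obtain ⟨S₂, h₂, H₂⟩ := (t.exists_finset_sends w x).1
  set S : Finset Ω := insert x (S₁ ∪ S₂)
  -- The extra `1` makes room for the starting point `x` and puts both codes strictly below `B`.
  set B := s.toCode + t.toCode + 1 with hB
  have hS : S.card ≤ B := by
    have : S.card ≤ (S₁ ∪ S₂).card + 1 := Finset.card_insert_le x (S₁ ∪ S₂)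
    have := Finset.card_union_le S₁ S₂
    omega
  have hxS : x ∈ S := Finset.mem_insert_self _ _
  have hsub : S₁ ∪ S₂ ⊆ S := Finset.subset_insert _ _
  obtain ⟨hy, Hy⟩ := H₁ S (Finset.union_subset_left hsub) hxS
  obtain ⟨hz, Hz⟩ := H₂ S (Finset.union_subset_right hsub) hxS
  have hrank : ∀ {x}, x ∈ S → S.rankIn x < B := fun hx =>
    (Finset.rankIn_lt_card hx).trans_le hS
  obtain ⟨m, hm, hmE⟩ := exists_bitTable_iff B (sendsTable w S B) (by
    rintro c b i j ⟨⟨hc, hb⟩, x, hx, y, hy, rfl, rfl, -⟩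
    exact ⟨hc, hb, hrank hx, hrank hy⟩)
  have hEq : bitTable m = sendsTable w S B := by
    funext c b i j
    exact propext (hmE c b i j)
  refine ⟨m, hm, ?_⟩
  rw [IsRefutation, hEq]
  refine ⟨isEvalTable_sendsTable w hS, S.rankIn x, hrank hxS, S.rankIn (s.eval w x), hrank hy,
    S.rankIn (t.eval w x), hrank hz, ⟨?_, ?_⟩, fun heq => hx (S.rankIn_injOn hy hz heq)⟩
  · exact sendsTable_toCode_iff.2 ⟨⟨by omega, by omega⟩, x, hxS, _, hy, rfl, rfl, Hy⟩
  · exact sendsTable_toCode_iff.2 ⟨⟨by omega, by omega⟩, x, hxS, _, hz, rfl, rfl, Hz⟩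

/-- The search bound depends on the codes alone, and the right side does not mention the universe
`u`. -/
theorem validInLGroups_iff (s t : LGroupTerm) :
    ValidInLGroups.{u} s t ↔ ¬ ∃ m < 2 ^ bitTableLength (s.toCode + t.toCode + 1),
      IsRefutation (s.toCode + t.toCode + 1) s.toCode t.toCode m := by
  rw [← not_iff_not, not_not]
  refine ⟨exists_isRefutation_of_not_validInLGroups, fun ⟨m, _, h⟩ => ?_⟩
  exact not_validInLGroups_of_isRefutation (by omega) (by omega) h

/-! ### Computability -/

section Primrec

variable {α : Type*} [Primcodable α]

theorem PrimrecPred.bounded_exists {f : α → ℕ} {p : α → ℕ → Prop} (hf : Primrec f)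
    (hp : PrimrecPred fun x : α × ℕ => p x.1 x.2) : PrimrecPred fun a => ∃ i < f a, p a i := by
  have h : PrimrecRel fun (i : ℕ) (a : α) => p a i :=
    PrimrecPred.comp hp (Primrec.pair Primrec.snd Primrec.fst)
  exact (h.exists_mem_list.comp (Primrec.list_range.comp hf) Primrec.id).of_eq (by simp)

theorem PrimrecPred.bounded_forall {f : α → ℕ} {p : α → ℕ → Prop} (hf : Primrec f)
    (hp : PrimrecPred fun x : α × ℕ => p x.1 x.2) : PrimrecPred fun a => ∀ i < f a, p a i := by
  have h : PrimrecRel fun (i : ℕ) (a : α) => p a i :=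
    PrimrecPred.comp hp (Primrec.pair Primrec.snd Primrec.fst)
  exact (h.forall_mem_list.comp (Primrec.list_range.comp hf) Primrec.id).of_eq (by simp)

theorem PrimrecPred.imp {p q : α → Prop} (hp : PrimrecPred p) (hq : PrimrecPred q) :
    PrimrecPred fun a => p a → q a :=
  (hp.not.or hq).of_eq fun _ => imp_iff_not_or.symm

theorem PrimrecPred.iff {p q : α → Prop} (hp : PrimrecPred p) (hq : PrimrecPred q) :
    PrimrecPred fun a => (p a ↔ q a) :=
  ((hp.imp hq).and (hq.imp hp)).of_eq fun _ => iff_def.symm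

theorem Primrec.two_pow {f : α → ℕ} (hf : Primrec f) : Primrec fun a => 2 ^ f a := by
  have h : Primrec fun n : ℕ => 2 ^ n :=
    (Primrec.nat_rec₁ (f := fun _ y => y * 2) 1
      (Primrec.nat_mul.comp Primrec.snd (Primrec.const 2))).of_eq fun n => by
      induction n with
      | zero => rfl
      | succ n ih => rw [pow_succ, ← ih]
  exact h.comp hf

theorem PrimrecPred.bitTable {m c b i j : α → ℕ} (hm : Primrec m) (hc : Primrec c)
    (hb : Primrec b) (hi : Primrec i) (hj : Primrec j) :
    PrimrecPred fun a => bitTable (m a) (c a) (b a) (i a) (j a) :=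
  Primrec.eq.comp (Primrec.nat_mod.comp (Primrec.nat_div.comp hm (Primrec.two_pow
    (Primrec₂.natPair.comp (Primrec₂.natPair.comp hc hb) (Primrec₂.natPair.comp hi hj))))
    (Primrec.const 2)) (Primrec.const 1)

end Primrec

/-- The conjunction exposes only bounded quantifiers and primitive recursive atoms, to which closure
rules apply. -/
theorem isEvalTable_iff {B : ℕ} {E : ℕ → ℕ → ℕ → ℕ → Prop} : IsEvalTable B E ↔
    (∀ i < B, ∀ j < B, E 0 1 i j → i = j) ∧
    (∀ i < B, ∀ j < B, E 0 0 i j → i = j) ∧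
    (∀ n < B, ∀ i < B, ∀ j < B, ∀ i' < B, ∀ j' < B,
    E (5 * n + 1) 1 i j → E (5 * n + 1) 1 i' j' → (i < i' ↔ j < j')) ∧
    (∀ n < B, ∀ i < B, ∀ j < B, E (5 * n + 1) 0 i j → E (5 * n + 1) 1 j i) ∧
    (∀ k < B, ∀ i < B, ∀ j < B, E (5 * k + 1 + 1) 1 i j → E k 0 i j) ∧
    (∀ k < B, ∀ i < B, ∀ j < B, E (5 * k + 1 + 1) 0 i j → E k 1 i j) ∧
    (∀ k < B, ∀ l < B, ∀ i < B, ∀ j < B, E (5 * Nat.pair k l + 2 + 1) 1 i j →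
    ∃ z < B, E l 1 i z ∧ E k 1 z j) ∧
    (∀ k < B, ∀ l < B, ∀ i < B, ∀ j < B, E (5 * Nat.pair k l + 2 + 1) 0 i j →
    ∃ z < B, E k 0 i z ∧ E l 0 z j) ∧
    (∀ k < B, ∀ l < B, ∀ i < B, ∀ j < B, E (5 * Nat.pair k l + 3 + 1) 1 i j →
    ∃ y < B, ∃ z < B, (E k 1 i y ∧ E l 1 i z) ∧ j = min y z) ∧
    (∀ k < B, ∀ l < B, ∀ i < B, ∀ j < B, E (5 * Nat.pair k l + 3 + 1) 0 i j →
    ∃ y < B, ∃ z < B, (E k 0 i y ∧ E l 0 i z) ∧ j = max y z) ∧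
    (∀ k < B, ∀ l < B, ∀ i < B, ∀ j < B, E (5 * Nat.pair k l + 4 + 1) 1 i j →
    ∃ y < B, ∃ z < B, (E k 1 i y ∧ E l 1 i z) ∧ j = max y z) ∧
    (∀ k < B, ∀ l < B, ∀ i < B, ∀ j < B, E (5 * Nat.pair k l + 4 + 1) 0 i j →
    ∃ y < B, ∃ z < B, (E k 0 i y ∧ E l 0 i z) ∧ j = min y z) :=
  ⟨fun ⟨h₁, h₂, h₃, h₄, h₅, h₆, h₇, h₈, h₉, h₁₀, h₁₁, h₁₂⟩ =>
    ⟨h₁, h₂, h₃, h₄, h₅, h₆, h₇, h₈, h₉, h₁₀, h₁₁, h₁₂⟩,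
  fun ⟨h₁, h₂, h₃, h₄, h₅, h₆, h₇, h₈, h₉, h₁₀, h₁₁, h₁₂⟩ =>
    ⟨h₁, h₂, h₃, h₄, h₅, h₆, h₇, h₈, h₉, h₁₀, h₁₁, h₁₂⟩⟩

theorem primrecPred_isEvalTable :
    PrimrecPred fun x : ℕ × ℕ => IsEvalTable x.1 (bitTable x.2) := by
  simp only [isEvalTable_iff]
  repeat'
    first
    | with_reducible exact Primrec.fst
    | with_reducible exact Primrec.snd
    | with_reducible refine Primrec.fst.comp ?_
    | with_reducible refine Primrec.snd.comp ?_
    | with_reducible exact Primrec.const _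
    | with_reducible refine Primrec.nat_add.comp ?_ ?_
    | with_reducible refine Primrec.nat_mul.comp ?_ ?_
    | with_reducible refine Primrec.nat_min.comp ?_ ?_
    | with_reducible refine Primrec.nat_max.comp ?_ ?_
    | with_reducible refine Primrec₂.natPair.comp ?_ ?_
    | with_reducible refine PrimrecPred.bitTable ?_ ?_ ?_ ?_ ?_
    | with_reducible refine PrimrecPred.bounded_forall ?_ ?_
    | with_reducible refine PrimrecPred.bounded_exists ?_ ?_
    | with_reducible refine PrimrecPred.and ?_ ?_
    | with_reducible refine PrimrecPred.imp ?_ ?_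
    | with_reducible refine PrimrecPred.iff ?_ ?_
    | with_reducible refine Primrec.eq.comp ?_ ?_
    | with_reducible refine Primrec.nat_lt.comp ?_ ?_

theorem primrecPred_isRefutation :
    PrimrecPred fun x : (ℕ × ℕ × ℕ) × ℕ => IsRefutation x.1.1 x.1.2.1 x.1.2.2 x.2 := by
  refine PrimrecPred.and ?_ ?_
  · exact primrecPred_isEvalTable.comp (Primrec.pair (Primrec.fst.comp Primrec.fst) Primrec.snd)
  · repeat'
      first
      | with_reducible exact Primrec.fst
      | with_reducible exact Primrec.snd
      | with_reducible refine Primrec.fst.comp ?_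
      | with_reducible refine Primrec.snd.comp ?_
      | with_reducible exact Primrec.const _
      | with_reducible refine PrimrecPred.bitTable ?_ ?_ ?_ ?_ ?_
      | with_reducible refine PrimrecPred.bounded_exists ?_ ?_
      | with_reducible refine PrimrecPred.and ?_ ?_
      | with_reducible refine PrimrecPred.not ?_
      | with_reducible refine Primrec.eq.comp ?_ ?_

theorem primrec_bitTableLength : Primrec bitTableLength :=
  Primrec₂.natPair.comp (Primrec₂.natPair.comp Primrec.id (Primrec.const 2))
    (Primrec₂.natPair.comp Primrec.id Primrec.id)

/-- The encoding of terms is by definition `toCode`, through `codeEquiv`. -/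
theorem LGroupTerm.primrec_toCode : Primrec LGroupTerm.toCode := Primrec.encode

theorem corollaryc :
    ComputablePred fun eqn : LGroupTerm × LGroupTerm => ValidInLGroups.{u} eqn.1 eqn.2 := by
  have hs : Primrec fun eqn : LGroupTerm × LGroupTerm => eqn.1.toCode :=
    LGroupTerm.primrec_toCode.comp Primrec.fst
  have ht : Primrec fun eqn : LGroupTerm × LGroupTerm => eqn.2.toCode :=
    LGroupTerm.primrec_toCode.comp Primrec.snd
  have hB := Primrec.succ.comp (Primrec.nat_add.comp hs ht)
  have hR := primrecPred_isRefutation.comp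
    (Primrec.pair ((Primrec.pair hB (Primrec.pair hs ht)).comp Primrec.fst) Primrec.snd)
  have h : PrimrecPred fun eqn : LGroupTerm × LGroupTerm => ValidInLGroups.{u} eqn.1 eqn.2 :=
    (PrimrecPred.bounded_exists (Primrec.two_pow (primrec_bitTableLength.comp hB)) hR).not.of_eq
      fun eqn => (validInLGroups_iff eqn.1 eqn.2).symm
  obtain ⟨hdec, hprim⟩ := h
  exact ⟨hdec, hprim.to_comp⟩
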